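/- Let $(\mathsf Y_i)_{i\ge 1}$ and $(\mathsf Z_i)_{i\ge 1}$ be real-valued stochastic processes on a common probability space, with arbitrary joint distribution, and let $\lambda\in[0,1]$. For $n\in\mathbb N$ put $\ell=\ell_n=\lfloor\lambda n\rfloor$ and let $\mathsf x=\mathsf x_n=[\mathsf Y_1\cdots \mathsf Y_{n-\ell}\ \mathsf Z_1\cdots \mathsf Z_\ell]^{\mathsf T}$, a random vector in $\mathbb R^n$; norms are Euclidean. For a non-empty bounded set $S\subseteq\mathbb R^n$ let $N_S(\delta)$ be the least number of open balls of radius $\delta$, with centres in $\mathbb R^n$, that cover $S$, and let $$\overline{\dim}_{\mathrm B}(S)=\limsup_{\delta\to0^+}\frac{\log N_S(\delta)}{\log(1/\delta)}$$ be its upper Minkowski dimension. For $\varepsilon>0$ define the upper Minkowski dimension compression rate $$\overline R_{\mathrm B}(\varepsilon)=\limsup_{n\to\infty}\ \inf\Big\{\tfrac1n\overline{\dim}_{\mathrm B}(S)\ :\ S\subseteq\mathbb R^n \text{ non-empty, bounded, Borel},\ \mathbb P[\mathsf x_n\in S]\ge 1-\varepsilon\Big\}.$$ **Theorem.** Let $\varepsilon>0$,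 let $R>\overline R_{\mathrm B}(\varepsilon)$ be a real number, and let $\beta>0$ satisfy $\beta<1-\overline R_{\mathrm B}(\varepsilon)/R$. Then there is an $N\in\mathbb N$ such that for every $n\ge N$ the following holds with $k=\lfloor Rn\rfloor$ and $\ell=\lfloor\lambda n\rfloor$. If $k\ge\ell$, then for every matrix $B\in\mathbb R^{k\times\ell}$ of full rank $\ell$, for Lebesgue-almost all matrices $A\in\mathbb R^{k\times(n-\ell)}$ (the exceptional set may depend on $B$), and for every $\kappa>0$, there is a map $g:\mathbb R^k\to\mathbb R^n$ that is $\beta$-Hölder continuous, i.e. $\|g(u)-g(v)\|\le c\,\|u-v\|^\beta$ for all $u,v\in\mathbb R^k$ with some constant $c$, such that $$\mathbb P\big[g([A\ B]\,\mathsf x)\ne \mathsf x\big]\le\varepsilon+\kappa .$$ -/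

import Mathlib

open MeasureTheory Filter Topology
open scoped NNReal Matrix

noncomputable section

/-- The covering number `N_S(δ)`: the least number of open balls of radius `δ`, with arbitrary
centres in the ambient space, that cover `S`. -/
def ballCoveringNumber {E : Type*} [PseudoMetricSpace E] (S : Set E) (δ : ℝ) : ℕ :=
  sInf {m : ℕ | ∃ c : Fin m → E, S ⊆ ⋃ i, Metric.ball (c i) δ}

/-- The upper Minkowski (box-counting) dimension
`limsup_{δ → 0+} log N_S(δ) / log (1/δ)`, meant for nonempty bounded sets `S`.
It is taken in the extended reals so that the upper limit always exists. -/
def upperMinkowskiDim {E : Type*} [PseudoMetricSpace E] (S : Set E) : EReal :=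
  limsup (fun δ : ℝ =>
    ((Real.log (ballCoveringNumber S δ : ℝ) / Real.log (1 / δ) : ℝ) : EReal)) (𝓝[>] (0 : ℝ))

/-- The number `ℓ = ⌊λ n⌋` of components of the source vector of dimension `n` that are taken
from the second process. -/
def numSecond (lam : ℝ) (n : ℕ) : ℕ := ⌊lam * (n : ℝ)⌋₊

/-- The number `n - ℓ` of components of the source vector that are taken from the first
process (for `λ ∈ [0, 1]` one has `ℓ ≤ n`, so the subtraction is the usual one). -/
def numFirst (lam : ℝ) (n : ℕ) : ℕ := n - numSecond lam n

/-- The space `ℝⁿ = ℝ^(n-ℓ) × ℝ^ℓ` with its Euclidean norm; the two blocks of coordinates are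
indexed by the two summands. -/
abbrev SourceSpace (lam : ℝ) (n : ℕ) : Type :=
  EuclideanSpace ℝ (Fin (numFirst lam n) ⊕ Fin (numSecond lam n))

/-- The concatenated source vector `[Y₁ … Y_{n-ℓ} Z₁ … Z_ℓ]ᵀ` (the processes are indexed
from `0`). -/
def sourceVector {Ω : Type*} (Y Z : ℕ → Ω → ℝ) (lam : ℝ) (n : ℕ) (ω : Ω) : SourceSpace lam n :=
  WithLp.toLp 2 (Sum.elim (fun i => Y (i : ℕ) ω) (fun i => Z (i : ℕ) ω))

/-- `a_n(ε)`: the infimum of `dim S / n`, with the upper Minkowski dimension, over the nonempty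
bounded Borel sets `S ⊆ ℝⁿ` that contain the source vector with probability at least `1 - ε`. -/
def upperDimRatio {Ω : Type*} [MeasurableSpace Ω] (P : Measure Ω) (Y Z : ℕ → Ω → ℝ)
    (lam ε : ℝ) (n : ℕ) : EReal :=
  sInf {d : EReal | ∃ S : Set (SourceSpace lam n), S.Nonempty ∧ Bornology.IsBounded S ∧
    MeasurableSet S ∧ 1 - ε ≤ P.real {ω | sourceVector Y Z lam n ω ∈ S} ∧
    d = upperMinkowskiDim S / (n : EReal)}

/-- The upper Minkowski dimension compression rate `limsup_{n → ∞} a_n(ε)`. -/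
def upperCompressionRate {Ω : Type*} [MeasurableSpace Ω] (P : Measure Ω) (Y Z : ℕ → Ω → ℝ)
    (lam ε : ℝ) : EReal :=
  limsup (fun n : ℕ => upperDimRatio P Y Z lam ε n) atTop

/-- The measurement `[A B] x` of a vector `x ∈ ℝ^(n-ℓ) × ℝ^ℓ`, as a vector of `ℝ^k` with its
Euclidean norm. -/
def measurement {k : ℕ} {lam : ℝ} {n : ℕ} (A : Matrix (Fin k) (Fin (numFirst lam n)) ℝ)
    (B : Matrix (Fin k) (Fin (numSecond lam n)) ℝ) (x : SourceSpace lam n) :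
    EuclideanSpace ℝ (Fin k) :=
  WithLp.toLp 2 (Matrix.fromCols A B *ᵥ x.ofLp)

end

/-! For large `n` there is a bounded Borel set `S` carrying the source with probability at least `1
- ε` and having upper Minkowski dimension below some `s < k (1 - β)`. Fix a point `x`. For `A`
uniform in a box, `[A B] u` has norm below `t` with probability at most a multiple of `(t / ‖u‖) ^
k`; full rank of `B` covers vectors `u` whose first block is negligible. Covering `S` at one scale
per dyadic shell around `x` and summing gives a convergent geometric series times `c ^ (k - s)`.
Letting `c → 0`, almost every `A` satisfies `c ‖x - x'‖ ^ (1 / β) ≤ ‖[A B] (x - x')‖` for all `x' ∈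
S` and some `c > 0` (`measure_forall_exists_lt_rpow_eq_zero`).

By Fubini, almost every `A` has this property at almost every source value `x`. Making `c` uniform
costs probability `κ`. On the remaining subset of `S` the measurement has a `β`-Hölder inverse,
which extends to all of `ℝ^k` by Lipschitz extension for the snowflake metric. -/

/-! ### Small-ball estimates for random matrices -/

theorem volume_box_inter_slab_le {ι : Type*} [Fintype ι] (y : ι → ℝ) {j₀ : ι} (hj : y j₀ ≠ 0)
    (b : ℝ) {r t : ℝ} (hr : 0 ≤ r) (ht : 0 ≤ t) :
    volume {a : ι → ℝ | (∀ j, |a j| ≤ r) ∧ |b + a ⬝ᵥ y| < t} ≤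
      ENNReal.ofReal (2 * (2 * r) ^ (Fintype.card ι - 1) * (t / |y j₀|)) := by
  classical
  -- Replacing coordinate `j₀` by `a ⬝ᵥ y` has determinant `y j₀` and maps the slab into a
  -- coordinate box.
  set T : (ι → ℝ) →ₗ[ℝ] (ι → ℝ) := Matrix.toLin' ((1 : Matrix ι ι ℝ).updateRow j₀ y) with hT
  have hTa (a : ι → ℝ) (j : ι) : T a j = if j = j₀ then a ⬝ᵥ y else a j := by
    rw [hT, Matrix.toLin'_apply]
    by_cases h : j = j₀
    · subst h
      simp [Matrix.mulVec, dotProduct_comm]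
    · simp [Matrix.mulVec, h, Matrix.one_apply, dotProduct]
  have hdet : LinearMap.det T = y j₀ := by
    rw [hT, LinearMap.det_toLin', ← Matrix.det_transpose, ← Matrix.updateCol_transpose,
      Matrix.transpose_one, ← Matrix.cramer_apply, Matrix.cramer_one]
    rfl
  set Q : Set (ι → ℝ) := Set.univ.pi fun j =>
    if j = j₀ then Set.Ioo (-b - t) (-b + t) else Set.Icc (-r) r with hQ
  have hsub : {a : ι → ℝ | (∀ j, |a j| ≤ r) ∧ |b + a ⬝ᵥ y| < t} ⊆ T ⁻¹' Q := by
    rintro a ⟨ha, hb⟩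
    simp only [hQ, Set.mem_preimage, Set.mem_univ_pi]
    intro j
    rw [hTa]
    by_cases h : j = j₀
    · rw [abs_lt] at hb
      simp only [h, if_true]
      constructor <;> linarith
    · simp only [h, if_false]
      exact abs_le.1 (ha j)
  have hvol : volume Q = ENNReal.ofReal (2 * t * (2 * r) ^ (Fintype.card ι - 1)) := by
    rw [hQ, volume_pi, Measure.pi_pi, ← Finset.mul_prod_erase _ _ (Finset.mem_univ j₀),
      Finset.prod_congr rfl (g := fun _ => ENNReal.ofReal (2 * r)), Finset.prod_const,
      Finset.card_erase_of_mem (Finset.mem_univ _), Finset.card_univ,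
      ENNReal.ofReal_mul (by positivity : (0 : ℝ) ≤ 2 * t),
      ENNReal.ofReal_pow (by positivity : (0 : ℝ) ≤ 2 * r)]
    · simp only [if_true, Real.volume_Ioo]
      congr 2
      ring
    · intro j hj
      simp only [Finset.ne_of_mem_erase hj, if_false, Real.volume_Icc]
      ring_nf
  refine (measure_mono hsub).trans ?_
  rw [Measure.addHaar_preimage_linearMap volume (by rwa [hdet]), hdet, hvol,
    ← ENNReal.ofReal_mul (abs_nonneg _), abs_inv]
  apply le_of_eq
  congr 1
  ring

/-- The rows of `A` vary independently, so the slab bounds multiply; this is the source of the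
exponent `k`. -/
theorem volume_box_inter_mulVec_le {κ ι : Type*} [Fintype κ] [Fintype ι] (y : ι → ℝ) {j₀ : ι}
    (hj : y j₀ ≠ 0) (b : κ → ℝ) {r t : ℝ} (hr : 0 ≤ r) (ht : 0 ≤ t) :
    volume {A : κ → ι → ℝ | (∀ i j, |A i j| ≤ r) ∧ ∀ i, |b i + A i ⬝ᵥ y| < t} ≤
      ENNReal.ofReal ((2 * (2 * r) ^ (Fintype.card ι - 1)) ^ Fintype.card κ *
        (t / |y j₀|) ^ Fintype.card κ) := by
  have : {A : κ → ι → ℝ | (∀ i j, |A i j| ≤ r) ∧ ∀ i, |b i + A i ⬝ᵥ y| < t} =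
      Set.univ.pi fun i => {a : ι → ℝ | (∀ j, |a j| ≤ r) ∧ |b i + a ⬝ᵥ y| < t} := by
    ext A
    simp [forall_and]
  rw [this, volume_pi, Measure.pi_pi, ← mul_pow, ENNReal.ofReal_pow (by positivity)]
  exact Finset.prod_le_pow_card _ _ _ fun i _ => volume_box_inter_slab_le y hj (b i) hr ht

theorem abs_dotProduct_le_of_abs_le {ι : Type*} [Fintype ι] {a y : ι → ℝ} {r : ℝ}
    (ha : ∀ j, |a j| ≤ r) : |a ⬝ᵥ y| ≤ Fintype.card ι * r * ‖y‖ := by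
  calc |a ⬝ᵥ y| ≤ ∑ j, |a j * y j| := Finset.abs_sum_le_sum_abs _ _
    _ ≤ ∑ _j : ι, r * ‖y‖ := by
        refine Finset.sum_le_sum fun j _ => ?_
        rw [abs_mul]
        exact mul_le_mul (ha j) (norm_le_pi_norm y j) (abs_nonneg _) ((abs_nonneg _).trans (ha j))
    _ = _ := by simp [mul_assoc]

theorem exists_pos_mul_norm_le_norm_mulVec {κ ι : Type*} [Fintype κ] [Fintype ι]
    (B : Matrix κ ι ℝ) (hB : B.rank = Fintype.card ι) :
    ∃ b : ℝ, 0 < b ∧ ∀ z : ι → ℝ, b * ‖z‖ ≤ ‖B *ᵥ z‖ := by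
  have hker : LinearMap.ker B.mulVecLin = ⊥ := by
    have h := B.mulVecLin.finrank_range_add_finrank_ker
    rw [← Matrix.rank, hB, Module.finrank_fintype_fun_eq_card] at h
    exact Submodule.finrank_eq_zero.1 (by omega)
  obtain ⟨K, hK, hanti⟩ := B.mulVecLin.exists_antilipschitzWith hker
  refine ⟨(K : ℝ)⁻¹, by positivity, fun z => ?_⟩
  have h := hanti.le_mul_dist z 0
  rw [map_zero, dist_zero_right, dist_zero_right, Matrix.mulVecLin_apply] at h
  rw [inv_mul_le_iff₀ (by exact_mod_cast hK)]
  exact h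

/-- A random matrix `[A B]`, with `B` injective and `A` uniform in a box, is unlikely to map a
nonzero vector close to the origin. -/
theorem exists_volume_fromCols_mulVec_lt_le {κ ι ι' : Type*} [Fintype κ] [Fintype ι] [Fintype ι']
    (B : Matrix κ ι' ℝ) (hB : B.rank = Fintype.card ι') {r : ℝ} (hr : 0 ≤ r) :
    ∃ K : ℝ, 0 ≤ K ∧ ∀ (u : EuclideanSpace ℝ (ι ⊕ ι')) (t : ℝ), u ≠ 0 → 0 < t →
      volume {A : κ → ι → ℝ | (∀ i j, |A i j| ≤ r) ∧
        ‖Matrix.fromCols (Matrix.of A) B *ᵥ u.ofLp‖ < t} ≤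
        ENNReal.ofReal (K * (t / ‖u‖) ^ Fintype.card κ) := by
  obtain ⟨b, hb, hBb⟩ := exists_pos_mul_norm_le_norm_mulVec B hB
  set k := Fintype.card κ
  set a : ℝ := Fintype.card ι * r + 1 with ha
  have ha0 : 0 < a := by positivity
  obtain ⟨D, hD, hnorm⟩ : ∃ D : ℝ, 0 < D ∧ ∀ u : EuclideanSpace ℝ (ι ⊕ ι'),
      ‖u‖ ≤ D * max ‖u.ofLp ∘ Sum.inl‖ ‖u.ofLp ∘ Sum.inr‖ := by
    refine ⟨(Fintype.card (ι ⊕ ι') : ℝ) ^ (1 / 2 : ℝ) + 1, by positivity, fun u => ?_⟩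
    have h := (PiLp.antilipschitzWith_ofLp 2 (fun _ : ι ⊕ ι' => ℝ)).le_mul_dist u 0
    have h2 : ‖u.ofLp‖ ≤ max ‖u.ofLp ∘ Sum.inl‖ ‖u.ofLp ∘ Sum.inr‖ := by
      refine (pi_norm_le_iff_of_nonneg (by positivity)).2 ?_
      rintro (j | j)
      · exact (norm_le_pi_norm (u.ofLp ∘ Sum.inl) j).trans (le_max_left _ _)
      · exact (norm_le_pi_norm (u.ofLp ∘ Sum.inr) j).trans (le_max_right _ _)
    rw [dist_zero_right, WithLp.ofLp_zero, dist_zero_right] at h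
    push_cast at h
    simp only [ENNReal.toReal_div, ENNReal.toReal_one, ENNReal.toReal_ofNat] at h
    refine h.trans (mul_le_mul (by linarith) h2 (by positivity) (by positivity))
  set V : ℝ := (volume {A : κ → ι → ℝ | ∀ i j, |A i j| ≤ r}).toReal with hV
  have hVfin : volume {A : κ → ι → ℝ | ∀ i j, |A i j| ≤ r} ≠ ⊤ := by
    refine ((measure_mono ?_).trans_lt
      (isCompact_closedBall (0 : κ → ι → ℝ) r).measure_lt_top).ne
    intro A hA
    rw [mem_closedBall_zero_iff]
    exact (pi_norm_le_iff_of_nonneg hr).2 fun i => (pi_norm_le_iff_of_nonneg hr).2 (hA i)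
  set M : ℝ := 1 + 2 * a / b + b / (2 * a) with hM
  have hM0 : 0 < M := by positivity
  set K₁ : ℝ := (2 * (2 * r) ^ (Fintype.card ι - 1)) ^ k with hK₁
  have hK₁0 : 0 ≤ K₁ := by positivity
  have hV0 : 0 ≤ V := ENNReal.toReal_nonneg
  refine ⟨K₁ * (D * M) ^ k + V * (2 * (D * M) / b) ^ k, by positivity, fun u t hu ht => ?_⟩
  have hu0 : 0 < ‖u‖ := norm_pos_iff.2 hu
  set y := u.ofLp ∘ Sum.inl with hy
  set z := u.ofLp ∘ Sum.inr with hz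
  have hmul (A : κ → ι → ℝ) (i : κ) :
      (Matrix.fromCols (Matrix.of A) B *ᵥ u.ofLp) i = (B *ᵥ z) i + A i ⬝ᵥ y := by
    rw [Matrix.fromCols_mulVec, Pi.add_apply, add_comm]
    rfl
  have hM1 : 1 ≤ M := by
    rw [hM, add_assoc]
    exact le_add_of_nonneg_right (by positivity)
  rw [add_mul, mul_assoc K₁, mul_assoc V, ← mul_pow (D * M), ← mul_pow (2 * (D * M) / b)]
  -- If `z` dominates, `A y` cannot cancel more than half of `B z`; otherwise `‖y‖` is comparable to
  -- `‖u‖` and the slab estimate applies. `M` is chosen to serve both cases.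
  by_cases hc : 2 * a * ‖y‖ < b * ‖z‖
  · have huz : ‖u‖ ≤ D * (M * ‖z‖) := by
      refine (hnorm u).trans (mul_le_mul_of_nonneg_left (max_le ?_ ?_) hD.le)
      · have h1 : ‖y‖ ≤ b / (2 * a) * ‖z‖ := by
          rw [div_mul_eq_mul_div, le_div_iff₀ (by positivity)]
          linarith
        refine h1.trans (mul_le_mul_of_nonneg_right ?_ (norm_nonneg _))
        exact le_add_of_nonneg_left (by positivity)
      · exact le_mul_of_one_le_left (norm_nonneg _) hM1
    by_cases ht' : t ≤ b / 2 * ‖z‖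
    · refine (measure_mono (t := ∅) ?_).trans (by simp)
      rintro A ⟨hA, hlt⟩
      have h1 : ‖B *ᵥ z‖ ≤ t + a * ‖y‖ := by
        refine (pi_norm_le_iff_of_nonneg (by positivity)).2 fun i => ?_
        have h2 := (norm_le_pi_norm _ i).trans hlt.le
        rw [hmul, Real.norm_eq_abs] at h2
        have h3 := abs_dotProduct_le_of_abs_le (y := y) (hA i)
        rw [Real.norm_eq_abs]
        have h4 := abs_sub_abs_le_abs_add ((B *ᵥ z) i) (A i ⬝ᵥ y)
        have h5 := norm_nonneg y
        rw [ha, add_mul]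
        linarith
      have := hBb z
      linarith
    -- Here `t` is so large that the claimed bound exceeds the volume `V` of the whole box.
    · have hone : 1 ≤ 2 * (D * M) / b * (t / ‖u‖) := by
        rw [div_mul_div_comm, one_le_div (by positivity)]
        calc b * ‖u‖ ≤ b * (D * (M * ‖z‖)) := mul_le_mul_of_nonneg_left huz hb.le
          _ = 2 * (D * M) * (b / 2 * ‖z‖) := by ring
          _ ≤ _ := mul_le_mul_of_nonneg_left (not_le.1 ht').le (by positivity)
      refine (measure_mono (t := {A : κ → ι → ℝ | ∀ i j, |A i j| ≤ r})
        (fun A hA => hA.1)).trans ?_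
      rw [← ENNReal.ofReal_toReal hVfin]
      refine ENNReal.ofReal_le_ofReal ?_
      refine le_trans ?_ (le_add_of_nonneg_left (by positivity))
      exact le_mul_of_one_le_right hV0 (one_le_pow₀ hone)
  · have huy : ‖u‖ ≤ D * (M * ‖y‖) := by
      refine (hnorm u).trans (mul_le_mul_of_nonneg_left (max_le ?_ ?_) hD.le)
      · exact le_mul_of_one_le_left (norm_nonneg _) hM1
      · have h1 : ‖z‖ ≤ 2 * a / b * ‖y‖ := by
          rw [div_mul_eq_mul_div, le_div_iff₀ (by positivity)]
          linarith
        refine h1.trans (mul_le_mul_of_nonneg_right ?_ (norm_nonneg _))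
        rw [hM]
        have : 0 < b / (2 * a) := by positivity
        linarith
    have hy0 : 0 < ‖y‖ := by
      by_contra h
      have h0 : ‖y‖ = 0 := le_antisymm (not_lt.1 h) (norm_nonneg _)
      rw [h0] at huy
      linarith
    have hne : Nonempty ι := by
      by_contra h
      rw [not_nonempty_iff] at h
      rw [Subsingleton.elim y 0, norm_zero] at hy0
      exact lt_irrefl _ hy0
    obtain ⟨j₀, hj₀⟩ := Finite.exists_max fun j => ‖y j‖
    have hyj : ‖y‖ = |y j₀| :=
      le_antisymm ((pi_norm_le_iff_of_nonneg (norm_nonneg _)).2 hj₀) (norm_le_pi_norm y j₀)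
    have hj0 : y j₀ ≠ 0 := by
      rw [hyj] at hy0
      exact abs_pos.1 hy0
    refine (measure_mono ?_).trans
      ((volume_box_inter_mulVec_le y hj0 (B *ᵥ z) hr ht.le).trans (ENNReal.ofReal_le_ofReal ?_))
    · rintro A ⟨hA, hlt⟩
      refine ⟨hA, fun i => ?_⟩
      rw [← hmul, ← Real.norm_eq_abs]
      exact (norm_le_pi_norm _ i).trans_lt hlt
    · refine le_trans ?_ (le_add_of_nonneg_right (by positivity))
      refine mul_le_mul_of_nonneg_left (pow_le_pow_left₀ (by positivity) ?_ _) hK₁0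
      rw [← hyj, ← mul_div_assoc, div_le_div_iff₀ hy0 hu0]
      calc t * ‖u‖ ≤ t * (D * (M * ‖y‖)) := mul_le_mul_of_nonneg_left huy ht.le
        _ = _ := by ring

theorem norm_fromCols_mulVec_le {κ ι ι' : Type*} [Fintype κ] [Fintype ι] [Fintype ι']
    (B : Matrix κ ι' ℝ) {r : ℝ} (hr : 0 ≤ r) :
    ∃ L : ℝ, 0 ≤ L ∧ ∀ (A : κ → ι → ℝ), (∀ i j, |A i j| ≤ r) →
      ∀ u : EuclideanSpace ℝ (ι ⊕ ι'), ‖Matrix.fromCols (Matrix.of A) B *ᵥ u.ofLp‖ ≤ L * ‖u‖ := by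
  obtain ⟨s, hs⟩ : ∃ s : ℝ, ∀ i j, |B i j| ≤ s := by
    refine ⟨∑ i, ∑ j, |B i j|, fun i j => ?_⟩
    exact (Finset.single_le_sum (f := fun j => |B i j|) (fun _ _ => abs_nonneg _)
      (Finset.mem_univ j)).trans (Finset.single_le_sum (f := fun i => ∑ j, |B i j|)
        (fun _ _ => Finset.sum_nonneg fun _ _ => abs_nonneg _) (Finset.mem_univ i))
  refine ⟨Fintype.card (ι ⊕ ι') * max r s, by positivity, fun A hA u => ?_⟩
  have hu : ‖u.ofLp‖ ≤ ‖u‖ :=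
    (pi_norm_le_iff_of_nonneg (norm_nonneg _)).2 fun j => PiLp.norm_apply_le u j
  refine (pi_norm_le_iff_of_nonneg (by positivity)).2 fun i => ?_
  refine (abs_dotProduct_le_of_abs_le (r := max r s) ?_).trans
    (mul_le_mul_of_nonneg_left hu (by positivity))
  rintro (j | j)
  · exact (hA i j).trans (le_max_left _ _)
  · exact (hs i j).trans (le_max_right _ _)

/-! ### Union bound over scales -/

section SmallBall

variable {Θ V : Type*} [MeasurableSpace Θ] {μ : Measure Θ} [SeminormedAddCommGroup V]
  {T : Set Θ} {φ : Θ → V → ℝ} {S : Set V} {K L s δ₀ : ℝ} {k : ℕ}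

/-- In each covering ball one far point represents all the others: two points of the ball differ by
at most `2 * δ`, so by the Lipschitz bound the threshold only grows to `(1 + 2 * L) * δ`. -/
theorem measure_exists_far_lt_le (hL : 0 ≤ L) (hK : 0 ≤ K)
    (hlip : ∀ θ ∈ T, ∀ u v, φ θ u ≤ φ θ v + L * ‖u - v‖)
    (hball : ∀ u t, ‖u‖ ≠ 0 → 0 < t →
      μ {θ | θ ∈ T ∧ φ θ u < t} ≤ ENNReal.ofReal (K * (t / ‖u‖) ^ k))
    {a δ : ℝ} (ha : 0 < a) (hδ : 0 < δ)
    (hcov : ∃ m : ℕ, (m : ℝ) ≤ δ ^ (-s) ∧ ∃ p : Fin m → V, S ⊆ ⋃ i, Metric.ball (p i) δ) (x : V) :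
    μ {θ | θ ∈ T ∧ ∃ x' ∈ S, a < ‖x - x'‖ ∧ φ θ (x - x') < δ} ≤
      ENNReal.ofReal (δ ^ (-s) * (K * ((1 + 2 * L) * δ / a) ^ k)) := by
  obtain ⟨m, hm, p, hp⟩ := hcov
  have key (i : Fin m) : ∃ E : Set Θ, μ E ≤ ENNReal.ofReal (K * ((1 + 2 * L) * δ / a) ^ k) ∧
      ∀ θ ∈ T, ∀ x' ∈ S, x' ∈ Metric.ball (p i) δ → a < ‖x - x'‖ → φ θ (x - x') < δ → θ ∈ E := by
    by_cases h : ∃ x' ∈ S, x' ∈ Metric.ball (p i) δ ∧ a < ‖x - x'‖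
    · obtain ⟨x₁, -, hx₁, hax₁⟩ := h
      have hpos : 0 < ‖x - x₁‖ := ha.trans hax₁
      refine ⟨{θ | θ ∈ T ∧ φ θ (x - x₁) < (1 + 2 * L) * δ},
        (hball _ _ hpos.ne' (by positivity)).trans (ENNReal.ofReal_le_ofReal ?_), ?_⟩
      · gcongr
      · intro θ hθ x' _ hx' _ hφ
        refine ⟨hθ, ?_⟩
        have h1 := hlip θ hθ (x - x₁) (x - x')
        have h2 : ‖x - x₁ - (x - x')‖ ≤ 2 * δ := by
          rw [sub_sub_sub_cancel_left, ← dist_eq_norm]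
          have := dist_triangle_right x' x₁ (p i)
          rw [Metric.mem_ball] at hx' hx₁
          linarith
        have h3 := mul_le_mul_of_nonneg_left h2 hL
        linarith
    · refine ⟨∅, by simp, fun θ _ x' hS hx' ha' _ => (h ⟨x', hS, hx', ha'⟩).elim⟩
  choose E hE hmem using key
  calc μ {θ | θ ∈ T ∧ ∃ x' ∈ S, a < ‖x - x'‖ ∧ φ θ (x - x') < δ} ≤ μ (⋃ i, E i) := by
        refine measure_mono ?_
        rintro θ ⟨hθ, x', hS, hax', hφ⟩
        obtain ⟨i, hi⟩ := Set.mem_iUnion.1 (hp hS)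
        exact Set.mem_iUnion.2 ⟨i, hmem i θ hθ x' hS hi hax' hφ⟩
    _ ≤ ∑ i, μ (E i) := measure_iUnion_fintype_le _ _
    _ ≤ ∑ _i : Fin m, ENNReal.ofReal (K * ((1 + 2 * L) * δ / a) ^ k) :=
        Finset.sum_le_sum fun i _ => hE i
    _ = ENNReal.ofReal (m * (K * ((1 + 2 * L) * δ / a) ^ k)) := by
        rw [ENNReal.ofReal_mul (Nat.cast_nonneg m)]
        simp
    _ ≤ _ := ENNReal.ofReal_le_ofReal (mul_le_mul_of_nonneg_right hm (by positivity))

/-- If the random functions `φ θ` satisfy a small-ball estimate of order `k` and `S` has upper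
Minkowski dimension less than `k (1 - β)`, then almost surely `φ θ` dominates a multiple of
`‖·‖ ^ (1 / β)` on the translate `x - S`. -/
theorem measure_forall_exists_lt_rpow_eq_zero (hL : 0 ≤ L) (hK : 0 ≤ K)
    (hφ : ∀ θ u, 0 ≤ φ θ u)
    (hlip : ∀ θ ∈ T, ∀ u v, φ θ u ≤ φ θ v + L * ‖u - v‖)
    (hball : ∀ u t, ‖u‖ ≠ 0 → 0 < t →
      μ {θ | θ ∈ T ∧ φ θ u < t} ≤ ENNReal.ofReal (K * (t / ‖u‖) ^ k))
    (hδ₀ : 0 < δ₀)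
    (hcov : ∀ δ, 0 < δ → δ < δ₀ →
      ∃ m : ℕ, (m : ℝ) ≤ δ ^ (-s) ∧ ∃ p : Fin m → V, S ⊆ ⋃ i, Metric.ball (p i) δ)
    (hS : Bornology.IsBounded S) {β : ℝ} (hβ : 0 < β) (hs : s < k * (1 - β)) (x : V) :
    μ {θ | θ ∈ T ∧ ∀ c : ℝ, 0 < c → ∃ x' ∈ S, φ θ (x - x') < c * ‖x - x'‖ ^ (1 / β)} = 0 := by
  obtain ⟨M, hM, hSM⟩ : ∃ M : ℝ, 0 < M ∧ ∀ x' ∈ S, ‖x - x'‖ ≤ M := by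
    obtain ⟨r, hr⟩ := (Metric.isBounded_iff_subset_closedBall x).1 hS
    refine ⟨max r 1, by positivity, fun x' hx' => ?_⟩
    rw [← dist_eq_norm, dist_comm]
    exact (Metric.mem_closedBall.1 (hr hx')).trans (le_max_left _ _)
  have hks : s < k := by nlinarith [(Nat.cast_nonneg k : (0 : ℝ) ≤ k)]
  -- Ratio of the shell bounds below; `s < k * (1 - β)` says exactly that this exponent is positive.
  set q : ℝ := (1 / 2 : ℝ) ^ ((k - s) / β - k) with hq
  have hq0 : 0 < q := by positivity
  have hq1 : q < 1 := by
    refine Real.rpow_lt_one (by norm_num) (by norm_num) ?_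
    rw [sub_pos, lt_div_iff₀ hβ]
    linarith
  set C : ℝ := K * ((1 + 2 * L) * 2 / M) ^ k with hC
  have hC0 : 0 ≤ C := by positivity
  set G : ENNReal := (1 - ENNReal.ofReal q)⁻¹ with hG
  have hGfin : G ≠ ⊤ := by
    rw [hG, Ne, ENNReal.inv_eq_top, tsub_eq_zero_iff_le, not_le]
    exact ENNReal.ofReal_lt_one.2 hq1
  have bound (c : ℝ) (hc : 0 < c) (hcδ : c < δ₀) :
      μ {θ | θ ∈ T ∧ ∀ c : ℝ, 0 < c → ∃ x' ∈ S, φ θ (x - x') < c * ‖x - x'‖ ^ (1 / β)} ≤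
        ENNReal.ofReal (C * c ^ ((k : ℝ) - s)) * G := by
    -- Shell `j` is `a j < ‖x - x'‖ ≤ M * (1 / 2) ^ j`; `δ j` bounds `c * (‖x - x'‖ / M) ^ (1 / β)`
    -- on it.
    set δ : ℕ → ℝ := fun j => c * ((1 / 2 : ℝ) ^ j) ^ (1 / β) with hδ
    set a : ℕ → ℝ := fun j => M * (1 / 2 : ℝ) ^ (j + 1) with ha
    have hδ0 (j : ℕ) : 0 < δ j := by positivity
    have hδlt (j : ℕ) : δ j < δ₀ := by
      refine lt_of_le_of_lt (mul_le_of_le_one_right hc.le ?_) hcδ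
      exact Real.rpow_le_one (by positivity) (pow_le_one₀ (by norm_num) (by norm_num))
        (by positivity)
    have ha0 (j : ℕ) : 0 < a j := by positivity
    have hterm (j : ℕ) : δ j ^ (-s) * (K * ((1 + 2 * L) * δ j / a j) ^ k) =
        C * c ^ ((k : ℝ) - s) * q ^ j := by
      have hρ : (0 : ℝ) < (1 / 2 : ℝ) ^ j := by positivity
      have h1 : δ j ^ (-s) * δ j ^ k = c ^ ((k : ℝ) - s) * ((1 / 2 : ℝ) ^ j) ^ ((k - s) / β) := by
        rw [← Real.rpow_natCast (δ j) k, ← Real.rpow_add (hδ0 j), hδ,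
          Real.mul_rpow hc.le (by positivity), ← Real.rpow_mul hρ.le]
        ring_nf
      have h2 : ((1 / 2 : ℝ) ^ j) ^ ((k - s) / β) = q ^ j * ((1 / 2 : ℝ) ^ j) ^ k := by
        rw [hq, ← Real.rpow_natCast _ k, ← Real.rpow_natCast _ j, ← Real.rpow_natCast _ j,
          ← Real.rpow_mul (by norm_num), ← Real.rpow_mul (by norm_num),
          ← Real.rpow_mul (by norm_num), ← Real.rpow_add (by norm_num)]
        ring_nf
      have h3 : (1 + 2 * L) * δ j / a j =
          (1 + 2 * L) * 2 / M * (δ j * ((1 / 2 : ℝ) ^ j)⁻¹) := by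
        simp only [ha, pow_succ]
        field_simp
      rw [h3, mul_pow, mul_pow, inv_pow, hC]
      calc _ = K * ((1 + 2 * L) * 2 / M) ^ k * (δ j ^ (-s) * δ j ^ k) *
            (((1 / 2 : ℝ) ^ j) ^ k)⁻¹ := by ring
        _ = _ := by
          rw [h1, h2]
          field_simp
    calc _ ≤ μ (⋃ j, {θ | θ ∈ T ∧ ∃ x' ∈ S, a j < ‖x - x'‖ ∧ φ θ (x - x') < δ j}) := by
          refine measure_mono ?_
          rintro θ ⟨hθ, h⟩
          obtain ⟨x', hx', hlt⟩ := h (c / M ^ (1 / β)) (by positivity)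
          have hxpos : 0 < ‖x - x'‖ := by
            refine lt_of_le_of_ne (norm_nonneg _) fun h0 => ?_
            rw [← h0, Real.zero_rpow (by positivity), mul_zero] at hlt
            exact absurd hlt (not_lt.2 (hφ _ _))
          obtain ⟨j, hj1, hj2⟩ := exists_nat_pow_near_of_lt_one (x := ‖x - x'‖ / M)
            (y := (1 / 2 : ℝ)) (by positivity) ((div_le_one hM).2 (hSM x' hx')) (by norm_num)
            (by norm_num)
          refine Set.mem_iUnion.2 ⟨j, hθ, x', hx', ?_, ?_⟩
          · rw [lt_div_iff₀ hM] at hj1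
            simp only [ha]
            linarith
          · refine hlt.trans_le ?_
            rw [div_mul_eq_mul_div, mul_div_assoc, ← Real.div_rpow hxpos.le hM.le]
            exact mul_le_mul_of_nonneg_left
              (Real.rpow_le_rpow (by positivity) hj2 (by positivity)) hc.le
      _ ≤ ∑' j, μ {θ | θ ∈ T ∧ ∃ x' ∈ S, a j < ‖x - x'‖ ∧ φ θ (x - x') < δ j} :=
          measure_iUnion_le _
      _ ≤ ∑' j, ENNReal.ofReal (C * c ^ ((k : ℝ) - s)) * ENNReal.ofReal q ^ j := by
          refine ENNReal.tsum_le_tsum fun j => ?_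
          refine (measure_exists_far_lt_le hL hK hlip hball (ha0 j) (hδ0 j)
            (hcov _ (hδ0 j) (hδlt j)) x).trans (le_of_eq ?_)
          rw [hterm, ENNReal.ofReal_mul (by positivity), ENNReal.ofReal_pow hq0.le]
      _ = _ := by rw [ENNReal.tsum_mul_left, ENNReal.tsum_geometric]
  have hlim : Tendsto (fun c : ℝ => ENNReal.ofReal (C * c ^ ((k : ℝ) - s)) * G) (𝓝[>] 0) (𝓝 0) := by
    have h1 : Tendsto (fun c : ℝ => C * c ^ ((k : ℝ) - s)) (𝓝[>] 0) (𝓝 0) := by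
      have h2 : Tendsto (fun c : ℝ => c ^ ((k : ℝ) - s)) (𝓝[>] 0) (𝓝 0) := by
        have h3 := (Real.continuousAt_rpow_const 0 ((k : ℝ) - s) (Or.inr (by linarith))).tendsto
        rw [Real.zero_rpow (by linarith)] at h3
        exact h3.mono_left nhdsWithin_le_nhds
      simpa using h2.const_mul C
    have h4 := ENNReal.Tendsto.mul_const (ENNReal.tendsto_ofReal h1) (b := G) (Or.inr hGfin)
    simpa using h4
  refine le_antisymm (ge_of_tendsto hlim ?_) zero_le
  filter_upwards [Ioo_mem_nhdsGT hδ₀] with c hc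
  exact bound c hc.1 hc.2

end SmallBall

/-! ### Covering numbers and dimension -/

theorem exists_cover_of_isBounded {E : Type*} [PseudoMetricSpace E] [ProperSpace E] {S : Set E}
    (hS : Bornology.IsBounded S) {δ : ℝ} (hδ : 0 < δ) :
    ∃ p : Fin (ballCoveringNumber S δ) → E, S ⊆ ⋃ i, Metric.ball (p i) δ := by
  have hne : {m : ℕ | ∃ c : Fin m → E, S ⊆ ⋃ i, Metric.ball (c i) δ}.Nonempty := by
    obtain ⟨t, ht, hcov⟩ := Metric.totallyBounded_iff.1 
      (hS.isCompact_closure.totallyBounded.subset subset_closure) δ hδ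
    have := ht.fintype
    refine ⟨Fintype.card t, fun i => ((Fintype.equivFin t).symm i : E), hcov.trans ?_⟩
    intro z hz
    obtain ⟨y, hy, hzy⟩ := Set.mem_iUnion₂.1 hz
    exact Set.mem_iUnion.2 ⟨Fintype.equivFin t ⟨y, hy⟩, by simpa using hzy⟩
  exact Nat.sInf_mem hne

theorem exists_cover_of_upperMinkowskiDim_lt {E : Type*} [PseudoMetricSpace E] [ProperSpace E]
    {S : Set E} (hS : Bornology.IsBounded S) {s : ℝ} (hs : upperMinkowskiDim S < (s : EReal)) :
    ∃ δ₀ : ℝ, 0 < δ₀ ∧ ∀ δ, 0 < δ → δ < δ₀ →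
      ∃ m : ℕ, (m : ℝ) ≤ δ ^ (-s) ∧ ∃ p : Fin m → E, S ⊆ ⋃ i, Metric.ball (p i) δ := by
  have h := eventually_lt_of_limsup_lt hs
  obtain ⟨ε, hε, h⟩ := mem_nhdsGT_iff_exists_Ioo_subset.1 h
  refine ⟨min ε 1, lt_min hε one_pos, fun δ hδ hlt => ?_⟩
  obtain ⟨hδε, hδ1⟩ := lt_min_iff.1 hlt
  refine ⟨ballCoveringNumber S δ, ?_, exists_cover_of_isBounded hS hδ⟩
  have h1 := h ⟨hδ, hδε⟩
  rw [Set.mem_ofPred_eq, EReal.coe_lt_coe_iff, one_div, Real.log_inv,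
    div_lt_iff₀ (neg_pos.2 (Real.log_neg hδ hδ1))] at h1
  -- The count is zero for empty `S`, where `Real.log 0 = 0` carries no information.
  rcases Nat.eq_zero_or_pos (ballCoveringNumber S δ) with h0 | h0
  · rw [h0, Nat.cast_zero]
    positivity
  · rw [← Real.log_le_log_iff (by exact_mod_cast h0) (by positivity), Real.log_rpow hδ]
    linarith

theorem upperMinkowskiDim_nonneg {E : Type*} [PseudoMetricSpace E] (S : Set E) :
    0 ≤ upperMinkowskiDim S := by
  refine le_limsup_of_frequently_le' (Eventually.frequently ?_)
  filter_upwards [Ioo_mem_nhdsGT one_pos] with δ hδ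
  rw [EReal.coe_nonneg, one_div, Real.log_inv]
  exact div_nonneg (Real.log_natCast_nonneg _) (neg_nonneg.2 (Real.log_neg hδ.1 hδ.2).le)

theorem upperCompressionRate_nonneg {Ω : Type*} [MeasurableSpace Ω] (P : Measure Ω)
    (Y Z : ℕ → Ω → ℝ) (lam ε : ℝ) : 0 ≤ upperCompressionRate P Y Z lam ε := by
  refine le_limsup_of_frequently_le' (Frequently.of_forall fun n => ?_)
  refine le_sInf ?_
  rintro d ⟨S, -, -, -, -, rfl⟩
  exact EReal.div_nonneg (upperMinkowskiDim_nonneg S) (Nat.cast_nonneg' n)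

/-! ### Hölder extension -/

/-- A Hölder function on a subset of a metric space, with exponent at most one and values in a
Euclidean space, extends to the whole space. -/
theorem HolderOnWith.exists_extend_euclidean {X ι : Type*} [PseudoMetricSpace X] [Fintype ι]
    {C β : ℝ≥0} (hβ : 0 < β) (hβ1 : β ≤ 1) {f : X → EuclideanSpace ℝ ι} {s : Set X}
    (hf : HolderOnWith C β f s) :
    ∃ g : X → EuclideanSpace ℝ ι, (∃ C' : ℝ≥0, HolderWith C' β g) ∧ Set.EqOn f g s := by
  have h0 : (0 : ℝ) < β := hβ
  have h1 : (β : ℝ) ≤ 1 := hβ1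
  -- For `β ≤ 1`, `dist ^ β` is again a metric, and `β`-Hölder maps become Lipschitz for it.
  let X' := Metric.Snowflaking X β h0 h1
  let π : X' → X := Metric.Snowflaking.ofSnowflaking
  have hlip : LipschitzOnWith C (fun x : X' => (f (π x)).ofLp) (π ⁻¹' s) := by
    intro x hx y hy
    have h2 := hf _ hx _ hy
    have h3 := (PiLp.lipschitzWith_ofLp 2 (fun _ : ι => ℝ)) (f (π x)) (f (π y))
    rw [ENNReal.coe_one, one_mul] at h3
    refine h3.trans (h2.trans ?_)
    rw [Metric.Snowflaking.edist_def]
  obtain ⟨g, hg, hgf⟩ := hlip.extend_pi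
  refine ⟨fun x => WithLp.toLp 2 (g (Metric.Snowflaking.toSnowflaking x)), ?_, ?_⟩
  · refine ⟨(Fintype.card ι : ℝ≥0) ^ (1 / (2 : ENNReal)).toReal * C, fun x y => ?_⟩
    have h2 := ((PiLp.lipschitzWith_toLp 2 (fun _ : ι => ℝ)).comp hg)
      (Metric.Snowflaking.toSnowflaking x) (Metric.Snowflaking.toSnowflaking y)
    rw [Metric.Snowflaking.edist_toSnowflaking_toSnowflaking] at h2
    exact h2
  · intro x hx
    have h2 := hgf (show Metric.Snowflaking.toSnowflaking x ∈ π ⁻¹' s from hx)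
    exact congrArg (WithLp.toLp 2) h2

/-! ### Almost sure lower bounds and the decoder -/

/-- For almost every `A`, the map `[A B]` has a Hölder lower bound at `x` on the set `S`. -/
theorem ae_exists_rpow_le_norm_fromCols_mulVec {κ ι ι' : Type*} [Fintype κ] [Fintype ι]
    [Fintype ι'] (B : Matrix κ ι' ℝ) (hB : B.rank = Fintype.card ι')
    {S : Set (EuclideanSpace ℝ (ι ⊕ ι'))} (hS : Bornology.IsBounded S) {s β : ℝ}
    (hdim : upperMinkowskiDim S < (s : EReal)) (hβ : 0 < β)
    (hs : s < Fintype.card κ * (1 - β)) (x : EuclideanSpace ℝ (ι ⊕ ι')) :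
    ∀ᵐ A : κ → ι → ℝ, ∃ N : ℕ, ∀ x' ∈ S, 1 / ((N : ℝ) + 1) * ‖x - x'‖ ^ (1 / β) ≤
      ‖Matrix.fromCols (Matrix.of A) B *ᵥ (x - x').ofLp‖ := by
  obtain ⟨δ₀, hδ₀, hcov⟩ := exists_cover_of_upperMinkowskiDim_lt hS hdim
  have key (r : ℕ) : ∀ᵐ A : κ → ι → ℝ, (∀ i j, |A i j| ≤ r) → ∃ c : ℝ, 0 < c ∧ ∀ x' ∈ S,
      c * ‖x - x'‖ ^ (1 / β) ≤ ‖Matrix.fromCols (Matrix.of A) B *ᵥ (x - x').ofLp‖ := by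
    obtain ⟨K, hK, hball⟩ :=
      exists_volume_fromCols_mulVec_lt_le (ι := ι) B hB (Nat.cast_nonneg r : (0 : ℝ) ≤ r)
    obtain ⟨L, hL, hlip⟩ :=
      norm_fromCols_mulVec_le (ι := ι) B (Nat.cast_nonneg r : (0 : ℝ) ≤ r)
    set φ : (κ → ι → ℝ) → EuclideanSpace ℝ (ι ⊕ ι') → ℝ :=
      fun A u => ‖Matrix.fromCols (Matrix.of A) B *ᵥ u.ofLp‖ with hφ
    have hlip' : ∀ A ∈ {A : κ → ι → ℝ | ∀ i j, |A i j| ≤ r}, ∀ u v,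
        φ A u ≤ φ A v + L * ‖u - v‖ := by
      intro A hA u v
      have h1 := hlip A hA (u - v)
      rw [WithLp.ofLp_sub, Matrix.mulVec_sub] at h1
      have h2 := norm_le_norm_add_norm_sub' (Matrix.fromCols (Matrix.of A) B *ᵥ u.ofLp)
        (Matrix.fromCols (Matrix.of A) B *ᵥ v.ofLp)
      exact h2.trans (by gcongr)
    have hball' : ∀ u t, ‖u‖ ≠ 0 → 0 < t →
        volume {A | A ∈ {A : κ → ι → ℝ | ∀ i j, |A i j| ≤ r} ∧ φ A u < t} ≤
          ENNReal.ofReal (K * (t / ‖u‖) ^ Fintype.card κ) :=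
      fun u t hu ht => hball u t (norm_ne_zero_iff.1 hu) ht
    have h := measure_forall_exists_lt_rpow_eq_zero hL hK (fun _ _ => norm_nonneg _) hlip' hball'
      hδ₀ hcov hS hβ hs x
    rw [ae_iff]
    refine measure_mono_null ?_ h
    intro A hA
    simp only [Set.mem_ofPred_eq, Classical.not_imp, not_exists, not_and, not_forall, not_le] at hA
    refine ⟨hA.1, fun c hc => ?_⟩
    obtain ⟨x', hx', hlt⟩ := hA.2 c hc
    exact ⟨x', hx', hlt⟩
  filter_upwards [ae_all_iff.2 key] with A hA
  obtain ⟨r, hr⟩ := exists_nat_ge ‖A‖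
  obtain ⟨c, hc, h⟩ := hA r fun i j =>
    ((norm_le_pi_norm (A i) j).trans (norm_le_pi_norm A i)).trans hr
  -- Restricting to the constants `1 / (N + 1)` leaves a countable union, as measurability in Fubini
  -- requires.
  obtain ⟨N, hN⟩ := exists_nat_one_div_lt hc
  exact ⟨N, fun x' hx' =>
    (mul_le_mul_of_nonneg_right hN.le (Real.rpow_nonneg (norm_nonneg _) _)).trans (h x' hx')⟩

theorem measurable_sourceVector {Ω : Type*} [MeasurableSpace Ω] {Y Z : ℕ → Ω → ℝ}
    (hY : ∀ i, Measurable (Y i)) (hZ : ∀ i, Measurable (Z i)) (lam : ℝ) (n : ℕ) :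
    Measurable (sourceVector Y Z lam n) := by
  refine (WithLp.measurable_toLp 2 _).comp (measurable_pi_iff.2 ?_)
  rintro (i | i)
  · exact hY i
  · exact hZ i

/-- Closedness survives the possibly uncountable intersection over `x' ∈ S`, and yields joint
measurability. -/
theorem isClosed_setOf_rpow_le_norm_fromCols_mulVec {κ ι ι' : Type*} [Fintype κ] [Fintype ι]
    [Fintype ι'] (B : Matrix κ ι' ℝ) (S : Set (EuclideanSpace ℝ (ι ⊕ ι'))) (c : ℝ) {q : ℝ}
    (hq : 0 ≤ q) :
    IsClosed {p : EuclideanSpace ℝ (ι ⊕ ι') × (κ → ι → ℝ) | ∀ x' ∈ S,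
      c * ‖p.1 - x'‖ ^ q ≤ ‖Matrix.fromCols (Matrix.of p.2) B *ᵥ (p.1 - x').ofLp‖} := by
  simp only [Set.ofPred_forall]
  refine isClosed_iInter fun x' => isClosed_iInter fun _ => isClosed_le ?_ ?_
  · exact continuous_const.mul
      ((continuous_fst.sub continuous_const).norm.rpow_const fun _ => Or.inr hq)
  · refine Continuous.norm (Continuous.matrix_mulVec ?_ ?_)
    · refine continuous_matrix fun i j => ?_
      rcases j with j | j
      · exact (continuous_apply_apply i j).comp continuous_snd
      · exact continuous_const
    · exact (PiLp.continuous_ofLp 2 _).comp (continuous_fst.sub continuous_const)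

theorem norm_fromCols_mulVec_sub_le_dist_measurement {k : ℕ} {lam : ℝ} {n : ℕ}
    (A : Matrix (Fin k) (Fin (numFirst lam n)) ℝ) (B : Matrix (Fin k) (Fin (numSecond lam n)) ℝ)
    (x x' : SourceSpace lam n) :
    ‖Matrix.fromCols A B *ᵥ (x - x').ofLp‖ ≤ dist (measurement A B x) (measurement A B x') := by
  have h : measurement A B x - measurement A B x' =
      WithLp.toLp 2 (Matrix.fromCols A B *ᵥ (x - x').ofLp) := by
    rw [WithLp.ofLp_sub, Matrix.mulVec_sub, WithLp.toLp_sub]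
    rfl
  rw [dist_eq_norm, h]
  exact (pi_norm_le_iff_of_nonneg (norm_nonneg _)).2 fun j =>
    PiLp.norm_apply_le (WithLp.toLp 2 (Matrix.fromCols A B *ᵥ (x - x').ofLp)) j

/-- A Hölder lower bound on a set yields a Hölder left inverse. -/
theorem exists_holderWith_leftInverse {X ι : Type*} [PseudoMetricSpace X] [Fintype ι]
    {H : EuclideanSpace ℝ ι → X} {T : Set (EuclideanSpace ℝ ι)} {β : ℝ≥0} (hβ : 0 < β)
    (hβ1 : β ≤ 1) {c : ℝ} (hc : 0 < c)
    (h : ∀ x ∈ T, ∀ x' ∈ T, c * ‖x - x'‖ ^ (1 / (β : ℝ)) ≤ dist (H x) (H x')) :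
    ∃ g : X → EuclideanSpace ℝ ι, (∃ C : ℝ≥0, HolderWith C β g) ∧ ∀ x ∈ T, g (H x) = x := by
  have hβ0 : (0 : ℝ) < β := hβ
  have hdist (x) (hx : x ∈ T) (x') (hx' : x' ∈ T) :
      dist x x' ≤ (c⁻¹) ^ (β : ℝ) * dist (H x) (H x') ^ (β : ℝ) := by
    have h1 := h x hx x' hx'
    rw [← le_inv_mul_iff₀ hc] at h1
    have h2 := Real.rpow_le_rpow (by positivity) h1 hβ0.le
    rwa [← Real.rpow_mul (norm_nonneg _), one_div_mul_cancel hβ0.ne', Real.rpow_one,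
      Real.mul_rpow (by positivity) dist_nonneg, ← dist_eq_norm] at h2
  have hinj : Set.InjOn H T := fun x hx x' hx' hxx' => by
    have h1 := hdist x hx x' hx'
    rw [hxx', dist_self, Real.zero_rpow hβ0.ne', mul_zero] at h1
    exact dist_le_zero.1 h1
  have hleft := hinj.leftInvOn_invFunOn
  have hhol : HolderOnWith (Real.toNNReal ((c⁻¹) ^ (β : ℝ))) β (Function.invFunOn H T) (H '' T) := by
    rintro _ ⟨x, hx, rfl⟩ _ ⟨x', hx', rfl⟩
    rw [hleft hx, hleft hx', edist_dist, edist_dist, ENNReal.ofReal_rpow_of_nonneg dist_nonneg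
      hβ0.le, ENNReal.ofNNReal_toNNReal, ← ENNReal.ofReal_mul (by positivity)]
    exact ENNReal.ofReal_le_ofReal (hdist x hx x' hx')
  obtain ⟨g, hg, hgeq⟩ := hhol.exists_extend_euclidean hβ hβ1
  exact ⟨g, hg, fun x hx => (hgeq (Set.mem_image_of_mem H hx)).symm.trans (hleft hx)⟩

theorem ae_exists_holderWith_decoder {Ω : Type*} [MeasurableSpace Ω] (P : Measure Ω)
    [IsProbabilityMeasure P] {Y Z : ℕ → Ω → ℝ} (hY : ∀ i, Measurable (Y i))
    (hZ : ∀ i, Measurable (Z i)) {lam ε : ℝ} {n k : ℕ} {S : Set (SourceSpace lam n)}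
    (hSb : Bornology.IsBounded S) (hSm : MeasurableSet S)
    (hSP : 1 - ε ≤ P.real {ω | sourceVector Y Z lam n ω ∈ S}) {s : ℝ} {β : ℝ≥0}
    (hβ : 0 < β) (hβ1 : β ≤ 1) (hdim : upperMinkowskiDim S < (s : EReal))
    (hs : s < k * (1 - β)) (B : Matrix (Fin k) (Fin (numSecond lam n)) ℝ)
    (hB : B.rank = numSecond lam n) :
    ∀ᵐ A : Fin k → Fin (numFirst lam n) → ℝ, ∀ κ : ℝ, 0 < κ →
      ∃ g : EuclideanSpace ℝ (Fin k) → SourceSpace lam n,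
        (∃ C : ℝ≥0, HolderWith C β g) ∧
        P.real {ω | g (measurement (Matrix.of A) B (sourceVector Y Z lam n ω)) ≠
          sourceVector Y Z lam n ω} ≤ ε + κ := by
  set X := sourceVector Y Z lam n
  have hX : Measurable X := measurable_sourceVector hY hZ lam n
  have hβ0 : (0 : ℝ) < β := hβ
  set Good : ℕ → Set (SourceSpace lam n × (Fin k → Fin (numFirst lam n) → ℝ)) := fun N =>
    {p | ∀ x' ∈ S, 1 / ((N : ℝ) + 1) * ‖p.1 - x'‖ ^ (1 / (β : ℝ)) ≤
      ‖Matrix.fromCols (Matrix.of p.2) B *ᵥ (p.1 - x').ofLp‖} with hGood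
  have hGm (N : ℕ) : MeasurableSet (Good N) :=
    (isClosed_setOf_rpow_le_norm_fromCols_mulVec B S _ (by positivity)).measurableSet
  have hmono : Monotone Good := by
    intro M N hMN p hp x' hx'
    refine le_trans (mul_le_mul_of_nonneg_right ?_ (by positivity)) (hp x' hx')
    exact Nat.one_div_le_one_div hMN
  have hae : ∀ᵐ ω ∂P, ∀ᵐ A : Fin k → Fin (numFirst lam n) → ℝ, ∃ N, (X ω, A) ∈ Good N :=
    Eventually.of_forall fun ω => ae_exists_rpow_le_norm_fromCols_mulVec B (by simpa using hB)
      hSb hdim hβ0 (by simpa using hs) (X ω)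
  -- Fubini: from "each `ω`, almost every `A`" to "almost every `A`, almost every `ω`".
  rw [Measure.ae_ae_comm] at hae
  · filter_upwards [hae] with A hA κ hκ
    set E : ℕ → Set Ω := fun N => {ω | X ω ∈ S ∧ (X ω, A) ∈ Good N} with hE
    have hEm (N : ℕ) : MeasurableSet (E N) :=
      (hX hSm).inter ((hX.prodMk measurable_const) (hGm N))
    have hEmono : Monotone E := fun M N hMN ω hω => ⟨hω.1, hmono hMN hω.2⟩
    have hlim := tendsto_measure_iUnion_atTop (μ := P) hEmono
    have hU : P (⋃ N, E N) = P {ω | X ω ∈ S} := by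
      refine measure_congr ?_
      filter_upwards [hA] with ω hω
      refine propext ⟨fun h => ?_, fun h => ?_⟩
      · obtain ⟨N, hN⟩ := Set.mem_iUnion.1 h
        exact hN.1
      · obtain ⟨N, hN⟩ := hω
        exact Set.mem_iUnion.2 ⟨N, h, hN⟩
    rw [hU] at hlim
    have hlim' : Tendsto (fun N => P.real (E N)) atTop (𝓝 (P.real {ω | X ω ∈ S})) :=
      (ENNReal.tendsto_toReal (measure_ne_top _ _)).comp hlim
    -- Continuity from below: one constant `1 / (N + 1)` works outside a part of `{X ∈ S}` of
    -- probability less than `κ`.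
    obtain ⟨N, hN⟩ := (hlim'.eventually (lt_mem_nhds
      (show P.real {ω | X ω ∈ S} - κ < P.real {ω | X ω ∈ S} by linarith))).exists
    obtain ⟨g, hg, hgT⟩ := exists_holderWith_leftInverse (H := measurement (Matrix.of A) B)
      (T := {x | x ∈ S ∧ (x, A) ∈ Good N}) hβ hβ1 (c := 1 / ((N : ℝ) + 1)) (by positivity)
      (fun x hx x' hx' => (hx.2 x' hx'.1).trans
        (norm_fromCols_mulVec_sub_le_dist_measurement _ _ _ _))
    refine ⟨g, hg, ?_⟩
    calc _ ≤ P.real (E N)ᶜ := measureReal_mono fun ω hω hωE =>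
          (show g (measurement (Matrix.of A) B (X ω)) ≠ X ω from hω) (hgT _ hωE)
      _ = 1 - P.real (E N) := by rw [measureReal_compl (hEm N)]; simp
      _ ≤ ε + κ := by linarith
  · simp only [Set.ofPred_exists]
    exact MeasurableSet.iUnion fun N =>
      ((hX.comp measurable_fst).prodMk measurable_snd) (hGm N)

/-! ### The main theorem -/

theorem theorem2 {Ω : Type*} [MeasurableSpace Ω] (P : Measure Ω) [IsProbabilityMeasure P]
    (Y Z : ℕ → Ω → ℝ) (hY : ∀ i, Measurable (Y i)) (hZ : ∀ i, Measurable (Z i))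
    (lam : ℝ) (hlam : lam ∈ Set.Icc (0 : ℝ) 1) (ε : ℝ) (hε : 0 < ε)
    (R : ℝ) (hR : upperCompressionRate P Y Z lam ε < (R : EReal))
    (β : ℝ≥0) (hβ : 0 < β)
    (hβR : ((β : ℝ) : EReal) < 1 - upperCompressionRate P Y Z lam ε / (R : EReal)) :
    ∃ N : ℕ, ∀ n : ℕ, N ≤ n → ∀ k : ℕ, k = ⌊R * (n : ℝ)⌋₊ → numSecond lam n ≤ k →
      ∀ B : Matrix (Fin k) (Fin (numSecond lam n)) ℝ, B.rank = numSecond lam n →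
        ∀ᵐ A : Fin k → Fin (numFirst lam n) → ℝ, ∀ κ : ℝ, 0 < κ →
          ∃ g : EuclideanSpace ℝ (Fin k) → SourceSpace lam n,
            (∃ C : ℝ≥0, HolderWith C β g) ∧
            P.real {ω | g (measurement (Matrix.of A) B (sourceVector Y Z lam n ω)) ≠
              sourceVector Y Z lam n ω} ≤ ε + κ := by
  have hr0 := upperCompressionRate_nonneg P Y Z lam ε
  obtain ⟨ρ, hρ⟩ : ∃ ρ : ℝ, upperCompressionRate P Y Z lam ε = (ρ : EReal) :=
    ⟨_, (EReal.coe_toReal (ne_top_of_lt hR) (ne_bot_of_gt (EReal.bot_lt_zero.trans_le hr0))).symm⟩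
  rw [hρ] at hR hβR hr0
  rw [EReal.coe_lt_coe_iff] at hR
  rw [EReal.coe_nonneg] at hr0
  have hβ0 : (0 : ℝ) < β := hβ
  have hR0 : 0 < R := hr0.trans_lt hR
  have hβρ : (β : ℝ) < 1 - ρ / R := by
    rw [← EReal.coe_div] at hβR
    exact_mod_cast hβR
  have hρR : ρ < R * (1 - β) := by
    have h1 : ρ / R < 1 - β := by linarith
    rw [div_lt_iff₀ hR0] at h1
    linarith
  have hβ1 : (β : ℝ) ≤ 1 := by
    have : 0 ≤ ρ / R := by positivity
    linarith
  obtain ⟨R', hρR', hR'⟩ := exists_between hρR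
  have hev : ∀ᶠ n : ℕ in atTop, upperDimRatio P Y Z lam ε n < (R' : EReal) := by
    refine eventually_lt_of_limsup_lt ?_
    change upperCompressionRate P Y Z lam ε < _
    rw [hρ]
    exact_mod_cast hρR'
  obtain ⟨N₁, hN₁⟩ := eventually_atTop.1 hev
  -- Beyond this threshold the rounding loss `k > R * n - 1` still leaves `R' * n < k * (1 - β)`.
  obtain ⟨N₂, hN₂⟩ := exists_nat_gt ((1 - β) / (R * (1 - β) - R'))
  refine ⟨max N₁ (max N₂ 1), fun n hn k hk _ B hB => ?_⟩
  have hn1 : 0 < n := (le_max_right _ _).trans ((le_max_right _ _).trans hn)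
  obtain ⟨d, ⟨S, -, hSb, hSm, hSP, rfl⟩, hd⟩ :=
    sInf_lt_iff.1 (hN₁ n ((le_max_left _ _).trans hn))
  have hn0 : (0 : ℝ) < n := by exact_mod_cast hn1
  have hdim : upperMinkowskiDim S < ((R' * n : ℝ) : EReal) := by
    rw [EReal.div_lt_iff (by exact_mod_cast hn1) (EReal.natCast_ne_top n)] at hd
    simpa using hd
  have hs : R' * n < k * (1 - β) := by
    have h1 : R * n < k + 1 := by
      rw [hk]
      exact Nat.lt_floor_add_one _
    have h2 : (N₂ : ℝ) ≤ n := by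
      exact_mod_cast (le_max_left _ _).trans ((le_max_right _ _).trans hn)
    have h3 := hN₂.trans_le h2
    rw [div_lt_iff₀ (by linarith)] at h3
    nlinarith
  exact ae_exists_holderWith_decoder P hY hZ hSb hSm hSP hβ hβ1 hdim hs B hB
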